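/- Let $[k]=\{1,\dots,k\}$. For integers $N>n\ge 1$ let $K_N$ be the complete graph on $[N]$; the vertices in $[n]$ are called terminals, the vertex $N$ is called the sink, and the terminals together with the sink are called the extended terminals. For a nonnegative weight map $w$ on the edges of $K_N$ and $\varnothing\neq I\subseteq[n]$ let $$S_I=\min\{\|C(W)\| : W\subseteq[N-1],\ W\cap[n]=I\},$$ where $\|C(W)\|$ is the total weight of the edges with exactly one endpoint in $W$. Let $H_n\subseteq\mathbb R^{2^n-1}$ be the cone of all vectors $S=(S_I)_{\varnothing\ne I\subseteq[n]}$ arising in this way from some $N>n$ and some $w$ (the holographic entropy cone). For $q\in\mathbb R^{2^n-1}$ write $qS=\sum_{\varnothing\ne I\subseteq[n]}q_IS_I$. The inequality $qS\ge0$ is a *facet* of $H_n$ if it holds for all $S\in H_n$ and the face $\{S\in H_n: qS=0\}$ has dimension $\dim H_n-1$. It is *balanced* if $\sum_{I\ni j}q_I=0$ for every $j\in[n]$. Identifying the symbols $S_A$ and $S_{A^c}$ for complementary nonempty proper subsets $A,A^c$ of the set of extended terminals, the permutations of the $n+1$ extended terminals act on inequalities by $S_I\mapsto S_{\sigma(I)}$;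 the inequality is *superbalanced* if every inequality in its orbit under this action is balanced. Let $K\subseteq[n]$ be the set of terminals $i$ with $q_I\ne0$ for some $I\ni i$. A *zero-lift* of $qS\ge0$ is an inequality $q'S'\ge0$ in $\mathbb R^{2^{n+1}-1}$ obtained by choosing pairwise disjoint non-empty sets $I_i\subseteq[n+1]$ for $i\in K$, and replacing each $S_I$ with $q_I\neq 0$ by $S'_{\bigcup_{i\in I}I_i}$. **Theorem.** If $qS\ge0$ is a superbalanced facet of $H_n$, then every zero-lift $q'S'\ge0$ of it is a superbalanced facet of $H_{n+1}$. -/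

import Mathlib

namespace HolographicEntropy

/-- Index set of `S`-vectors on `n` terminals: the nonempty subsets of the terminal set `Fin n`. -/
abbrev Idx (n : ℕ) : Type := {I : Finset (Fin n) // I.Nonempty}

/-- Vectors in `ℝ ^ (2 ^ n - 1)`, with entries indexed by the nonempty sets of terminals. -/
abbrev Vec (n : ℕ) : Type := Idx n → ℝ

/-- Extended terminals: `some i` is the terminal `i` and `none` is the sink (purifying vertex). -/
abbrev ExtTerminal (n : ℕ) : Type := Option (Fin n)

/-- Vertex set of the complete graph on `N = n + 1 + b` vertices: the `n` terminals and the sink,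
followed by `b` bulk vertices. -/
abbrev Vertex (n b : ℕ) : Type := ExtTerminal n ⊕ Fin b

/-- Total weight of the edges with exactly one endpoint in `W`. The weight map is given on all
unordered pairs; the values on the diagonal (loops) never enter. -/
def cutWeight {V : Type*} [Fintype V] [DecidableEq V] (w : Sym2 V → NNReal) (W : Finset V) : ℝ :=
  ∑ u ∈ W, ∑ v ∈ Wᶜ, (w s(u, v) : ℝ)

/-- `W` avoids the sink and contains precisely the terminals in `I`
(and an arbitrary set of bulk vertices). -/
def CutsOut {n b : ℕ} (W : Finset (Vertex n b)) (I : Finset (Fin n)) : Prop :=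
  Sum.inl none ∉ W ∧ ∀ i : Fin n, Sum.inl (some i) ∈ W ↔ i ∈ I

/-- The weight map `w` realizes `S`: every entry `S_I` is the minimum weight of a cut `W` that
contains precisely the terminals in `I`. -/
def Realizes {n b : ℕ} (w : Sym2 (Vertex n b) → NNReal) (S : Vec n) : Prop :=
  ∀ I : Idx n,
    IsLeast {x : ℝ | ∃ W : Finset (Vertex n b), CutsOut W I.1 ∧ x = cutWeight w W} (S I)

/-- The holographic entropy cone `H_n` on `n` terminals. -/
def H (n : ℕ) : Set (Vec n) :=
  {S | ∃ (b : ℕ) (w : Sym2 (Vertex n b) → NNReal), Realizes w S}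

/-- The linear form `q S`, the sum of all `q_I S_I`. -/
def eval {n : ℕ} (q S : Vec n) : ℝ := ∑ I, q I * S I

/-- `q S ≥ 0` is a valid inequality for `C`. -/
def IsValid {n : ℕ} (C : Set (Vec n)) (q : Vec n) : Prop := ∀ S ∈ C, 0 ≤ eval q S

/-- The roots of `q S ≥ 0` in `C`: the face of `C` which the inequality defines. -/
def roots {n : ℕ} (C : Set (Vec n)) (q : Vec n) : Set (Vec n) := {S ∈ C | eval q S = 0}

/-- `q S ≥ 0` is a facet of the cone `C`: it is valid, and the face it defines has dimension one
less than `C`. The dimension of a cone is the dimension of its linear hull. -/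
def IsFacet {n : ℕ} (C : Set (Vec n)) (q : Vec n) : Prop :=
  IsValid C q ∧
    Module.finrank ℝ (Submodule.span ℝ (roots C q)) + 1 = Module.finrank ℝ (Submodule.span ℝ C)

/-- Coefficients of the inequality obtained from `q S ≥ 0` by replacing every `S_I` by `S_{f I}`
and collecting terms. -/
def substitute {n m : ℕ} (f : Finset (Fin n) → Finset (Fin m)) (q : Vec n) : Vec m :=
  fun J => ∑ I : Idx n, if f I.1 = J.1 then q I else 0

/-- Each terminal occurs in `q` with total coefficient zero. -/
def Balanced {n : ℕ} (q : Vec n) : Prop :=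
  ∀ j : Fin n, ∑ I : Idx n, (if j ∈ I.1 then q I else 0) = 0

/-- A set `A` of extended terminals is represented by a set of terminals, through the
identification of `A` with its complement: `A` itself if it does not contain the sink, and the
complement of `A` if it does. -/
def representative {n : ℕ} (A : Finset (ExtTerminal n)) : Finset (Fin n) :=
  if none ∈ A then Finset.eraseNone Aᶜ else Finset.eraseNone A

/-- Action of a permutation of the extended terminals on sets of terminals, with the
identification of a set of extended terminals with its complement. -/
def permSet {n : ℕ} (σ : Equiv.Perm (ExtTerminal n)) (I : Finset (Fin n)) : Finset (Fin n) :=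
  representative ((I.image some).image σ)

/-- Every inequality in the orbit of `q S ≥ 0` under the permutations of the `n + 1` extended
terminals is balanced. (The identity permutation gives that `q` itself is balanced.) -/
def Superbalanced {n : ℕ} (q : Vec n) : Prop :=
  ∀ σ : Equiv.Perm (ExtTerminal n), Balanced (substitute (permSet σ) q)

/-- The set `K` of terminals that appear in `q S ≥ 0`. -/
def appearing {n : ℕ} (q : Vec n) : Set (Fin n) := {i | ∃ I : Idx n, q I ≠ 0 ∧ i ∈ I.1}

/-- `q' S' ≥ 0` is the zero-lift of `q S ≥ 0` from `n` to `n + 1` terminals given by the sets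
`T i`, where `i` runs through the terminals that appear in `q`: these sets are nonempty and
pairwise disjoint, and `q'` arises by replacing every terminal `i ∈ I` in every `S_I` by `T i`.
(The values of `T` at terminals that do not appear in `q` play no role.) -/
def IsZeroLiftAlong {n : ℕ} (T : Fin n → Finset (Fin (n + 1))) (q : Vec n) (q' : Vec (n + 1)) :
    Prop :=
  (∀ i ∈ appearing q, (T i).Nonempty) ∧
    (appearing q).PairwiseDisjoint T ∧
    q' = substitute (fun I => I.biUnion T) q

/-- `q' S' ≥ 0` is a zero-lift of `q S ≥ 0`. -/
def IsZeroLift {n : ℕ} (q : Vec n) (q' : Vec (n + 1)) : Prop :=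
  ∃ T : Fin n → Finset (Fin (n + 1)), IsZeroLiftAlong T q q'

end HolographicEntropy

/-!
A zero-lift along disjoint sets `T i` is governed by the map `π` of extended terminals which sends
the elements of `T i` to `i` and everything else to the sink: `q' S' = q (push π S')`, where
`push π S'` is the `S`-vector of the graph in which terminals with the same label under `π` have
been merged (`push_mem_H`). Hence `q'` is valid. An inequality is superbalanced exactly when all
Bell pairs (single edges between extended terminals) satisfy it with equality
(`superbalanced_iff`), and merging turns a Bell pair into a Bell pair or zero, so `q'` is
superbalanced.

For the dimension of the face, suppose that `z ≠ z'` have the same label, and let `A` be a set of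
extended terminals with `z' ∈ A` and `z ∉ A`. The star graph with legs of weight `1` to `A` and of
weight `#A - 1` to `z` differs from the sum of the Bell pairs from `z` to `A` by the indicator of
the sets which separate `z` from all of `A` (`sepIndicator_eq`). No set occurring in `q'` separates
`z` from `z'`, so this indicator is in the span of the roots of `q'`. By Möbius inversion so is
every unit vector at a set separating two extended terminals with the same label
(`single_mem_span`). The remaining coordinates are those of `push π S'`: with a section `ρ` of `π`
onto its image, `S' - push ρ (push π S')` is in the span of the roots of `q'` for every `S'`
(`sub_push_mem_span`). Since `push ρ` maps `H n` to the larger cone and takes roots of `q` to roots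
of `q'`, the span of the larger cone exceeds that of its roots by at most the one dimension by which
the span of `H n` exceeds the span of the roots of `q`, and it does exceed it, because `q` does not
vanish on `H n`. No knowledge of the dimension of either cone is needed.
-/

namespace HolographicEntropy

open Finset

/-- A set of terminals, viewed as a set of extended terminals (which avoids the sink). -/
abbrev toExt {n : ℕ} (J : Finset (Fin n)) : Finset (ExtTerminal n) :=
  J.map Function.Embedding.some

/-- The entries of an `S`-vector, extended to the empty set by `S_∅ = 0`. -/
def entry {n : ℕ} (S : Vec n) (J : Finset (Fin n)) : ℝ := if h : J.Nonempty then S ⟨J, h⟩ else 0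

@[simp] lemma entry_coe {n : ℕ} (S : Vec n) (J : Idx n) : entry S J.1 = S J := by
  simp [entry, J.2]

lemma toExt_injective {n : ℕ} : Function.Injective (toExt (n := n)) :=
  Finset.map_injective _

lemma none_notMem_toExt {n : ℕ} (J : Finset (Fin n)) : none ∉ toExt J := by
  simp

lemma cutsOut_iff {n b : ℕ} (W : Finset (Vertex n b)) (I : Finset (Fin n)) :
    CutsOut W I ↔ ∀ u, Sum.inl u ∈ W ↔ u ∈ toExt I := by
  constructor
  · rintro ⟨h0, h1⟩ (_ | i)
    · simpa using h0
    · simpa using h1 i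
  · intro h
    exact ⟨by simpa using h none, fun i => by simpa using h (some i)⟩

lemma cutWeight_eq_sum_ite {V : Type*} [Fintype V] [DecidableEq V] (w : Sym2 V → NNReal)
    (W : Finset V) :
    cutWeight w W = ∑ u, ∑ v, if u ∈ W ∧ v ∉ W then (w s(u, v) : ℝ) else 0 := by
  simp only [cutWeight, ite_and, Finset.sum_ite_irrel, Finset.sum_const_zero]
  rw [← Finset.sum_filter, Finset.filter_univ_mem]
  refine Finset.sum_congr rfl fun u _ => ?_
  rw [← Finset.sum_filter]
  exact Finset.sum_congr (by ext; simp) fun _ _ => rfl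

/-! ### Relabelling terminals -/

/-- The set of terminals which `φ` maps into `I`. -/
def pre {m n : ℕ} (φ : ExtTerminal m → ExtTerminal n) (I : Finset (Fin n)) : Finset (Fin m) :=
  univ.filter fun a => φ (some a) ∈ toExt I

lemma mem_toExt_pre {m n : ℕ} {φ : ExtTerminal m → ExtTerminal n} (hφ : φ none = none)
    (I : Finset (Fin n)) (u : ExtTerminal m) : u ∈ toExt (pre φ I) ↔ φ u ∈ toExt I := by
  cases u <;> simp [pre, hφ]

lemma pre_empty {m n : ℕ} (φ : ExtTerminal m → ExtTerminal n) : pre φ ∅ = ∅ := by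
  simp [pre]

lemma pre_comp {l m n : ℕ} {φ : ExtTerminal m → ExtTerminal n} {ψ : ExtTerminal l → ExtTerminal m}
    (hφ : φ none = none) (hψ : ψ none = none) (I : Finset (Fin n)) :
    pre (φ ∘ ψ) I = pre ψ (pre φ I) := by
  refine toExt_injective (Finset.ext fun u => ?_)
  rw [mem_toExt_pre (by simp [hφ, hψ]), mem_toExt_pre hψ, mem_toExt_pre hφ]
  rfl

/-- The effect on `S`-vectors of relabelling the extended terminals along `φ`: terminals with the
same label are merged, and terminals whose label is `none` are merged with the sink. -/
def push {m n : ℕ} (φ : ExtTerminal m → ExtTerminal n) : Vec m →ₗ[ℝ] Vec n where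
  toFun S I := entry S (pre φ I.1)
  map_add' S S' := by
    funext I
    simp only [entry, Pi.add_apply]
    split <;> simp
  map_smul' c S := by
    funext I
    simp only [entry, Pi.smul_apply, RingHom.id_apply]
    split <;> simp

lemma push_apply {m n : ℕ} (φ : ExtTerminal m → ExtTerminal n) (S : Vec m) (I : Idx n) :
    push φ S I = entry S (pre φ I.1) := rfl

lemma entry_push {m n : ℕ} (φ : ExtTerminal m → ExtTerminal n) (S : Vec m) (I : Finset (Fin n)) :
    entry (push φ S) I = entry S (pre φ I) := by
  by_cases h : I.Nonempty
  · simp only [entry, h, dif_pos, push_apply]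
  · rw [Finset.not_nonempty_iff_eq_empty] at h
    subst h
    simp [entry, pre_empty]

lemma push_push {l m n : ℕ} {φ : ExtTerminal m → ExtTerminal n} {ψ : ExtTerminal l → ExtTerminal m}
    (hφ : φ none = none) (hψ : ψ none = none) (S : Vec l) :
    push φ (push ψ S) = push (φ ∘ ψ) S := by
  funext I
  rw [push_apply, push_apply, entry_push, pre_comp hφ hψ]

/-- The image of a weighted graph under a map of vertices: weights of parallel edges add up. -/
def mapWeight {V V' : Type*} [Fintype V] [DecidableEq V'] (f : V → V') (w : Sym2 V → NNReal) :
    Sym2 V' → NNReal :=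
  Sym2.lift ⟨fun x y => ∑ u, ∑ v, if f u = x ∧ f v = y then w s(u, v) else 0, fun x y => by
    dsimp only
    rw [Finset.sum_comm]
    refine Finset.sum_congr rfl fun u _ => Finset.sum_congr rfl fun v _ => ?_
    rw [Sym2.eq_swap]
    simp only [and_comm]⟩

lemma cutWeight_mapWeight {V V' : Type*} [Fintype V] [DecidableEq V] [Fintype V'] [DecidableEq V']
    (f : V → V') (w : Sym2 V → NNReal) (W : Finset V') :
    cutWeight (mapWeight f w) W = cutWeight w (univ.filter fun u => f u ∈ W) := by
  rw [cutWeight_eq_sum_ite w]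
  simp only [cutWeight, mapWeight, Sym2.lift_mk, NNReal.coe_sum, Finset.mem_filter,
    Finset.mem_univ, true_and]
  rw [← Finset.sum_product', Finset.sum_comm]
  refine Finset.sum_congr rfl fun u _ => ?_
  rw [Finset.sum_comm]
  refine Finset.sum_congr rfl fun v _ => ?_
  rw [Finset.sum_product]
  have h : ∀ x y, ((if f u = x ∧ f v = y then w s(u, v) else 0 : NNReal) : ℝ)
      = if f u = x then (if f v = y then (w s(u, v) : ℝ) else 0) else 0 := by
    intro x y
    split_ifs <;> simp_all
  simp only [h, Finset.sum_ite_irrel, Finset.sum_const_zero, Finset.sum_ite_eq, Finset.mem_compl]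
  split_ifs <;> simp_all

/-- Merging terminals realizes the relabelled `S`-vector. -/
lemma push_mem_H {m n : ℕ} {φ : ExtTerminal m → ExtTerminal n} (hφ : φ none = none) {S : Vec m}
    (hS : S ∈ H m) : push φ S ∈ H n := by
  obtain ⟨b, w, hw⟩ := hS
  refine ⟨b, mapWeight (Sum.map φ id) w, fun I => ?_⟩
  -- the cuts of the merged graph which cut out `I` are the cuts which cut out `pre φ I`
  have key : {x : ℝ | ∃ W : Finset (Vertex n b), CutsOut W I.1 ∧
        x = cutWeight (mapWeight (Sum.map φ id) w) W}
      = {x : ℝ | ∃ W : Finset (Vertex m b), CutsOut W (pre φ I.1) ∧ x = cutWeight w W} := by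
    ext x
    constructor
    · rintro ⟨W, hW, rfl⟩
      refine ⟨_, ?_, cutWeight_mapWeight _ _ _⟩
      rw [cutsOut_iff] at hW ⊢
      intro u
      rw [mem_toExt_pre hφ, ← hW]
      simp
    · rintro ⟨W, hW, rfl⟩
      rw [cutsOut_iff] at hW
      refine ⟨(toExt I.1).disjSum (univ.filter fun c => Sum.inr c ∈ W), ?_, ?_⟩
      · rw [cutsOut_iff]
        intro u
        rw [Finset.inl_mem_disjSum]
      · rw [cutWeight_mapWeight]
        congr 1
        ext (u | c)
        · rw [hW, mem_toExt_pre hφ, Finset.mem_filter, Sum.map_inl, Finset.inl_mem_disjSum]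
          simp
        · rw [Finset.mem_filter, Sum.map_inr, Finset.inr_mem_disjSum]
          simp
  rw [key, push_apply]
  by_cases h : (pre φ I.1).Nonempty
  · rw [entry, dif_pos h]
    exact hw ⟨_, h⟩
  · rw [entry, dif_neg h]
    rw [Finset.not_nonempty_iff_eq_empty] at h
    rw [h]
    refine ⟨⟨∅, by simp [cutsOut_iff], by simp [cutWeight]⟩, ?_⟩
    rintro x ⟨W, -, rfl⟩
    exact Finset.sum_nonneg fun _ _ => Finset.sum_nonneg fun _ _ => NNReal.coe_nonneg _

/-- Terms with `f I = ∅` are dropped by `substitute`, in accordance with `entry S ∅ = 0`. -/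
lemma eval_substitute {n m : ℕ} (f : Finset (Fin n) → Finset (Fin m)) (q : Vec n) (S : Vec m) :
    eval (substitute f q) S = ∑ I, q I * entry S (f I.1) := by
  simp only [eval, substitute, Finset.sum_mul]
  rw [Finset.sum_comm]
  refine Finset.sum_congr rfl fun I _ => ?_
  by_cases h : (f I.1).Nonempty
  · rw [Finset.sum_eq_single ⟨f I.1, h⟩]
    · simp [entry, h]
    · intro J _ hJ
      rw [if_neg, zero_mul]
      exact fun e => hJ (Subtype.ext e.symm)
    · simp
  · rw [entry, dif_neg h, mul_zero]
    refine Finset.sum_eq_zero fun J _ => ?_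
    rw [if_neg, zero_mul]
    exact fun e => h (e ▸ J.2)

/-! ### Star graphs and Bell pairs -/

/-- The set `J` of terminals contains exactly one of the extended terminals `u` and `v`. -/
def Sep {n : ℕ} (J : Finset (Fin n)) (u v : ExtTerminal n) : Prop := ¬(u ∈ toExt J ↔ v ∈ toExt J)

instance {n : ℕ} (J : Finset (Fin n)) (u v : ExtTerminal n) : Decidable (Sep J u v) := by
  unfold Sep; infer_instance

/-- The `S`-vector of a Bell pair: a single edge of weight one between `u` and `v`. -/
def bell {n : ℕ} (u v : ExtTerminal n) : Vec n := fun J => if Sep J.1 u v then 1 else 0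

/-- The `S`-vector of a star graph whose centre is a bulk vertex and whose leaves are the extended
terminals, the edge to `u` having weight `w u`. -/
def star {n : ℕ} (w : ExtTerminal n → NNReal) : Vec n :=
  fun J => min (∑ u, if u ∈ toExt J.1 then (w u : ℝ) else 0)
    (∑ u, if u ∉ toExt J.1 then (w u : ℝ) else 0)

/-- The weights of the star graph which realizes `star w`. -/
def starWeight {n : ℕ} (w : ExtTerminal n → NNReal) : Sym2 (Vertex n 1) → NNReal :=
  Sym2.lift ⟨fun x y => match x, y with
    | .inl u, .inr _ => w u
    | .inr _, .inl u => w u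
    | _, _ => 0, by rintro (x | x) (y | y) <;> rfl⟩

lemma cutWeight_starWeight {n : ℕ} (w : ExtTerminal n → NNReal) {W : Finset (Vertex n 1)}
    {I : Finset (Fin n)} (hW : CutsOut W I) :
    cutWeight (starWeight w) W = if Sum.inr 0 ∈ W then ∑ u, if u ∉ toExt I then (w u : ℝ) else 0
      else ∑ u, if u ∈ toExt I then (w u : ℝ) else 0 := by
  rw [cutsOut_iff] at hW
  rw [cutWeight_eq_sum_ite, Fintype.sum_sum_type]
  simp only [Fintype.sum_sum_type, hW, starWeight, Sym2.lift_mk, Finset.univ_unique,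
    Finset.sum_singleton, Fin.default_eq_zero, NNReal.coe_zero, ite_self, Finset.sum_const_zero,
    zero_add, add_zero]
  by_cases h : (Sum.inr 0 : Vertex n 1) ∈ W <;> simp [h]

lemma star_mem_H {n : ℕ} (w : ExtTerminal n → NNReal) : star w ∈ H n := by
  refine ⟨1, starWeight w, fun I => ⟨?_, ?_⟩⟩
  · rcases min_choice (∑ u, if u ∈ toExt I.1 then (w u : ℝ) else 0)
      (∑ u, if u ∉ toExt I.1 then (w u : ℝ) else 0) with h | h
    · have hW : CutsOut ((toExt I.1).disjSum (∅ : Finset (Fin 1))) I.1 := by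
        rw [cutsOut_iff]
        intro u
        rw [Finset.inl_mem_disjSum]
      refine ⟨_, hW, ?_⟩
      rw [cutWeight_starWeight w hW, if_neg (by simp), star, h]
    · have hW : CutsOut ((toExt I.1).disjSum (univ : Finset (Fin 1))) I.1 := by
        rw [cutsOut_iff]
        intro u
        rw [Finset.inl_mem_disjSum]
      refine ⟨_, hW, ?_⟩
      rw [cutWeight_starWeight w hW, if_pos (by simp), star, h]
  · rintro x ⟨W, hW, rfl⟩
    rw [cutWeight_starWeight w hW]
    split_ifs
    · exact min_le_right _ _
    · exact min_le_left _ _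

lemma entry_bell {n : ℕ} (u v : ExtTerminal n) (J : Finset (Fin n)) :
    entry (bell u v) J = if Sep J u v then 1 else 0 := by
  by_cases h : J.Nonempty
  · simp [entry, h, bell]
  · rw [Finset.not_nonempty_iff_eq_empty] at h
    simp [entry, h, Sep]

lemma sep_pre {m n : ℕ} {φ : ExtTerminal m → ExtTerminal n} (hφ : φ none = none)
    (I : Finset (Fin n)) (u v : ExtTerminal m) : Sep (pre φ I) u v ↔ Sep I (φ u) (φ v) := by
  rw [Sep, Sep, mem_toExt_pre hφ, mem_toExt_pre hφ]

lemma push_bell {m n : ℕ} {φ : ExtTerminal m → ExtTerminal n} (hφ : φ none = none)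
    (u v : ExtTerminal m) : push φ (bell u v) = bell (φ u) (φ v) := by
  funext I
  simp only [push_apply, entry_bell, sep_pre hφ, bell]

/-- The vector `1` at the sets which separate `z` from every element of `A`, and `0` elsewhere. -/
def sepIndicator {n : ℕ} (z : ExtTerminal n) (A : Finset (ExtTerminal n)) : Vec n :=
  fun J => if ∀ u ∈ A, Sep J.1 u z then 1 else 0

/-- Compare the star graph with legs of weight one to `A` and a leg of weight `#A - 1` to `z` with
the Bell pairs between `z` and the elements of `A`: if `J` separates `k` elements of `A` from `z`,
the Bell pairs contribute `k` and the star graph contributes `min k (2 * #A - 1 - k)`; these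
differ only for `k = #A`. -/
lemma sepIndicator_eq {n : ℕ} {z : ExtTerminal n} {A : Finset (ExtTerminal n)} (hz : z ∉ A)
    (hA : A.Nonempty) :
    sepIndicator z A = ∑ u ∈ A, bell u z -
      star (fun u => (if u ∈ A then 1 else 0) + if u = z then ((#A - 1 : ℕ) : NNReal) else 0) := by
  funext J
  have hpos : 1 ≤ #A := hA.card_pos
  have hle : #{u ∈ A | Sep J.1 u z} ≤ #A := Finset.card_filter_le _ _
  have hcompl := Finset.card_filter_add_card_filter_not (s := A) (fun u => Sep J.1 u z)
  have hbell : (∑ u ∈ A, bell u z) J = #{u ∈ A | Sep J.1 u z} := by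
    rw [Finset.sum_apply]
    simp [bell]
  have hiff : (∀ u ∈ A, Sep J.1 u z) ↔ #{u ∈ A | Sep J.1 u z} = #A := by
    rw [Finset.card_filter_eq_iff]
  have hsum (P : ExtTerminal n → Prop) [DecidablePred P] :
      (∑ u, if P u then (((if u ∈ A then 1 else 0) +
        if u = z then ((#A - 1 : ℕ) : NNReal) else 0 : NNReal) : ℝ) else 0)
      = #{u ∈ A | P u} + if P z then (#A - 1 : ℝ) else 0 := by
    have hterm (u) : (if P u then (((if u ∈ A then 1 else 0) +
        if u = z then ((#A - 1 : ℕ) : NNReal) else 0 : NNReal) : ℝ) else 0)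
        = (if u ∈ A ∧ P u then 1 else 0) +
          if u = z then (if P z then (#A - 1 : ℝ) else 0) else 0 := by
      by_cases h1 : P u <;> by_cases h2 : u ∈ A <;> by_cases h3 : u = z <;>
        simp_all
    rw [Finset.sum_congr rfl fun u _ => hterm u, Finset.sum_add_distrib, Finset.sum_ite_eq',
      if_pos (Finset.mem_univ z), Finset.sum_boole]
    congr 3
    ext u
    simp
  simp only [Pi.sub_apply, hbell, star, hsum, sepIndicator, hiff]
  have hmin : (if #{u ∈ A | Sep J.1 u z} = #A then (1 : ℝ) else 0) = #{u ∈ A | Sep J.1 u z} -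
      min (#{u ∈ A | Sep J.1 u z} : ℝ) (#{u ∈ A | ¬Sep J.1 u z} + (#A - 1)) := by
    have hc : (#{u ∈ A | Sep J.1 u z} : ℝ) + #{u ∈ A | ¬Sep J.1 u z} = #A := by
      exact_mod_cast hcompl
    split_ifs with h
    · rw [h] at hc ⊢
      rw [min_eq_right] <;> linarith
    · have hlt : (#{u ∈ A | Sep J.1 u z} : ℝ) + 1 ≤ #A := by
        exact_mod_cast lt_of_le_of_ne hle h
      rw [min_eq_left, sub_self]
      linarith
  rw [hmin]
  by_cases hzJ : z ∈ toExt J.1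
  · simp only [Sep, hzJ, iff_true, not_not, not_true, if_true, if_false, add_zero]
    rw [min_comm]
  · simp only [Sep, hzJ, iff_false, not_not, not_false_iff, if_true, if_false, add_zero]

lemma bell_mem_H {n : ℕ} (u v : ExtTerminal n) : bell u v ∈ H n := by
  have h : bell u v
      = star (fun x => (if x = u then 1 else 0) + if x = v then (1 : NNReal) else 0) := by
    funext J
    have hsum (P : ExtTerminal n → Prop) [DecidablePred P] :
        (∑ x, if P x then (((if x = u then 1 else 0) +
          if x = v then 1 else 0 : NNReal) : ℝ) else 0)
        = (if P u then 1 else 0) + if P v then 1 else 0 := by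
      have hterm (x) : (if P x then (((if x = u then 1 else 0) +
          if x = v then 1 else 0 : NNReal) : ℝ) else 0)
          = (if x = u then (if P u then 1 else 0) else 0) +
            if x = v then (if P v then 1 else 0) else 0 := by
        by_cases h1 : P x <;> by_cases h2 : x = u <;> by_cases h3 : x = v <;> simp_all
      rw [Finset.sum_congr rfl fun x _ => hterm x, Finset.sum_add_distrib, Finset.sum_ite_eq',
        Finset.sum_ite_eq', if_pos (Finset.mem_univ u), if_pos (Finset.mem_univ v)]
    simp only [bell, star, hsum, Sep]
    by_cases hu : u ∈ toExt J.1 <;> by_cases hv : v ∈ toExt J.1 <;> simp [hu, hv]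
  rw [h]
  exact star_mem_H _

lemma eval_bell {n : ℕ} (q : Vec n) (u v : ExtTerminal n) :
    eval q (bell u v) = ∑ I : Idx n, if Sep I.1 u v then q I else 0 := by
  simp [eval, bell]

/-- A set of extended terminals and its complement separate the same pairs, so passing to the
representative amounts to testing separation from the sink. -/
lemma mem_permSet {n : ℕ} (σ : Equiv.Perm (ExtTerminal n)) (I : Finset (Fin n)) (j : Fin n) :
    j ∈ permSet σ I ↔ Sep I (σ.symm (some j)) (σ.symm none) := by
  have hmem (x) : x ∈ (I.image some).image σ ↔ σ.symm x ∈ toExt I := by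
    simp only [Finset.mem_image, Finset.mem_map, Function.Embedding.some_apply,
      exists_exists_and_eq_and, ← Equiv.eq_symm_apply]
  rw [permSet, representative, Sep, ← hmem, ← hmem]
  split_ifs with h <;> simp only [Finset.mem_eraseNone, Finset.mem_compl, h] <;> tauto

/-- An inequality is superbalanced precisely if every Bell pair satisfies it with equality. -/
lemma superbalanced_iff {n : ℕ} (q : Vec n) :
    Superbalanced q ↔ ∀ u v, eval q (bell u v) = 0 := by
  have key (σ : Equiv.Perm (ExtTerminal n)) (j : Fin n) :
      ∑ J : Idx n, (if j ∈ J.1 then substitute (permSet σ) q J else 0)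
        = eval q (bell (σ.symm (some j)) (σ.symm none)) := by
    have h1 : ∑ J : Idx n, (if j ∈ J.1 then substitute (permSet σ) q J else 0)
        = eval (substitute (permSet σ) q) (bell (some j) none) := by
      rw [eval_bell]
      simp [Sep]
    rw [h1, eval_substitute, eval_bell]
    refine Finset.sum_congr rfl fun I _ => ?_
    have h2 : Sep (permSet σ I.1) (some j) none ↔ j ∈ permSet σ I.1 := by simp [Sep]
    simp only [entry_bell, h2, mem_permSet, mul_ite, mul_one, mul_zero]
  constructor
  · intro h u v
    by_cases huv : u = v
    · simp [eval_bell, Sep, huv]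
    · obtain ⟨j, hj⟩ : ∃ j, Equiv.swap v none u = some j := by
        rw [← Option.ne_none_iff_exists']
        intro h0
        rw [Equiv.swap_apply_eq_iff, Equiv.swap_apply_right] at h0
        exact huv h0
      have := h (Equiv.swap v none) j
      rw [key, ← hj] at this
      simpa using this
  · intro h σ j
    rw [key, h]

/-! ### Dimension of the lifted face -/

lemma eval_sub {n : ℕ} (q S S' : Vec n) : eval q (S - S') = eval q S - eval q S' := by
  simp [eval, mul_sub, Finset.sum_sub_distrib]

lemma eval_sum {n : ℕ} {ι : Type*} (q : Vec n) (s : Finset ι) (S : ι → Vec n) :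
    eval q (∑ i ∈ s, S i) = ∑ i ∈ s, eval q (S i) := by
  simp only [eval, Finset.sum_apply, Finset.mul_sum]
  exact Finset.sum_comm

lemma eval_eq_zero_of_mem_span {n : ℕ} {C : Set (Vec n)} {q S : Vec n}
    (hS : S ∈ Submodule.span ℝ (roots C q)) : eval q S = 0 := by
  induction hS using Submodule.span_induction with
  | mem x hx => exact hx.2
  | zero => simp [eval]
  | add x y _ _ hx hy =>
    have h : x + y = ∑ i : Fin 2, ![x, y] i := by simp
    rw [h, eval_sum]
    simp [hx, hy]
  | smul c x _ hx =>
    have h : eval q (c • x) = c * eval q x := by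
      simp only [eval, Finset.mul_sum, Pi.smul_apply, smul_eq_mul]
      exact Finset.sum_congr rfl fun _ _ => by ring
    rw [h, hx, mul_zero]

lemma finrank_sup_span_singleton {V : Type*} [AddCommGroup V] [Module ℝ V] [FiniteDimensional ℝ V]
    {R : Submodule ℝ V} {x : V} (hx : x ∉ R) :
    Module.finrank ℝ ↥(R ⊔ Submodule.span ℝ {x}) = Module.finrank ℝ R + 1 := by
  have hx0 : x ≠ 0 := fun h => hx (h ▸ R.zero_mem)
  have hd : Disjoint R (Submodule.span ℝ {x}) := by
    rw [Submodule.disjoint_span_singleton' hx0]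
    exact hx
  have := Submodule.finrank_sup_add_finrank_inf_eq R (Submodule.span ℝ {x})
  rwa [hd.eq_bot, finrank_bot, finrank_span_singleton hx0, add_zero] at this

section Lift

variable {m n : ℕ} {q : Vec n} {q' : Vec m} {π : ExtTerminal m → ExtTerminal n}

lemma superbalanced_of_eval_eq (hπ : π none = none)
    (heval : ∀ S', eval q' S' = eval q (push π S')) (hq : Superbalanced q) :
    Superbalanced q' := by
  rw [superbalanced_iff] at hq ⊢
  intro u v
  rw [heval, push_bell hπ, hq]

/-- If `A` contains an extended terminal with the same label as `z`, no set occurring in `q'`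
separates `z` from `A`. -/
lemma sepIndicator_mem_span (hπ : π none = none)
    (heval : ∀ S', eval q' S' = eval q (push π S')) (hq' : Superbalanced q')
    {z z' : ExtTerminal m} (hzz' : π z = π z') {A : Finset (ExtTerminal m)} (hz : z ∉ A)
    (hz' : z' ∈ A) : sepIndicator z A ∈ Submodule.span ℝ (roots (H m) q') := by
  rw [superbalanced_iff] at hq'
  have heq := sepIndicator_eq hz ⟨z', hz'⟩
  have h0 : push π (sepIndicator z A) = 0 := by
    funext I
    rw [push_apply, entry]
    split_ifs with h
    · refine if_neg fun hall => ?_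
      have := hall z' hz'
      rw [sep_pre hπ, hzz'] at this
      exact this Iff.rfl
    · rfl
  have heval0 : eval q' (sepIndicator z A) = 0 := by
    rw [heval, h0]
    simp [eval]
  rw [heq]
  refine Submodule.sub_mem _ (Submodule.sum_mem _ fun u _ => ?_) ?_
  · exact Submodule.subset_span ⟨bell_mem_H u z, hq' u z⟩
  · refine Submodule.subset_span ⟨star_mem_H _, ?_⟩
    rw [heq, eval_sub, eval_sum, Finset.sum_eq_zero fun u _ => hq' u z, zero_sub,
      neg_eq_zero] at heval0
    exact heval0

/-- Möbius inversion: the unit vectors at the sets which separate `z` and `z'` are combinations of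
the vectors `sepIndicator z A` with `z' ∈ A`. -/
lemma single_mem_span (hπ : π none = none)
    (heval : ∀ S', eval q' S' = eval q (push π S')) (hq' : Superbalanced q')
    {z z' : ExtTerminal m} (hzz' : π z = π z') (J : Idx m) (hJ : Sep J.1 z' z) :
    (Pi.single J 1 : Vec m) ∈ Submodule.span ℝ (roots (H m) q') := by
  let side (J : Idx m) : Finset (ExtTerminal m) := univ.filter fun u => Sep J.1 u z
  have hside : Function.Injective side := by
    intro J J' h
    have h1 (u) : Sep J.1 u z ↔ Sep J'.1 u z := by
      simpa [side] using Finset.ext_iff.1 h u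
    have h2 : z ∈ toExt J.1 ↔ z ∈ toExt J'.1 := by
      have := h1 none
      simp only [Sep, none_notMem_toExt, false_iff, not_not] at this
      exact this
    refine Subtype.ext (toExt_injective (Finset.ext fun u => ?_))
    have := h1 u
    simp only [Sep] at this
    tauto
  have hind (J : Idx m) : sepIndicator z (side J)
      = ∑ J' ∈ univ.filter (fun J' => side J ⊆ side J'), (Pi.single J' 1 : Vec m) := by
    funext J'
    rw [Finset.sum_apply]
    simp [sepIndicator, side, Finset.subset_iff, Pi.single_apply]
  induction hk : (side J)ᶜ using Finset.strongInduction generalizing J with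
  | H s ih =>
    subst hk
    -- the unit vectors at the strictly larger sets are covered by the induction hypothesis
    have hsplit := Finset.add_sum_erase (univ.filter fun J' => side J ⊆ side J')
      (fun J' => (Pi.single J' 1 : Vec m)) (a := J) (by simp)
    rw [← hind, ← eq_sub_iff_add_eq] at hsplit
    rw [hsplit]
    have hz' : z' ∈ side J := by simpa [side] using hJ
    refine Submodule.sub_mem _ (sepIndicator_mem_span hπ heval hq' hzz' (by simp [side, Sep]) hz')
      (Submodule.sum_mem _ fun J' hJ' => ?_)
    rw [Finset.mem_erase, Finset.mem_filter] at hJ'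
    refine ih _ ?_ J' (by simpa [side] using hJ'.2.2 hz') rfl
    rw [Finset.compl_ssubset_compl]
    exact hJ'.2.2.ssubset_of_ne fun h => hJ'.1 (hside h).symm

/-- Up to roots, an `S`-vector is determined by its entries at the sets which are compatible with
the labelling. -/
lemma sub_push_mem_span (hπ : π none = none)
    (heval : ∀ S', eval q' S' = eval q (push π S')) (hq' : Superbalanced q')
    {ρ : ExtTerminal n → ExtTerminal m} (hρ : ρ none = none) (hπρπ : ∀ u, π (ρ (π u)) = π u)
    (S : Vec m) : S - push ρ (push π S) ∈ Submodule.span ℝ (roots (H m) q') := by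
  rw [push_push hρ hπ]
  have hsum (T : Vec m) : T = ∑ J, T J • (Pi.single J 1 : Vec m) := by
    funext J
    simp [Finset.sum_apply, Pi.single_apply]
  rw [hsum (S - push (ρ ∘ π) S)]
  refine Submodule.sum_mem _ fun J _ => ?_
  by_cases h : ∃ z z', π z = π z' ∧ Sep J.1 z' z
  · obtain ⟨z, z', hzz', hJ⟩ := h
    exact Submodule.smul_mem _ _ (single_mem_span hπ heval hq' hzz' J hJ)
  · have hpre : pre (ρ ∘ π) J.1 = J.1 := by
      refine toExt_injective (Finset.ext fun u => ?_)
      rw [mem_toExt_pre (by simp [hπ, hρ])]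
      by_contra hne
      exact h ⟨u, ρ (π u), (hπρπ u).symm, hne⟩
    rw [Pi.sub_apply, push_apply, hpre, entry_coe, sub_self, zero_smul]
    exact Submodule.zero_mem _

/-- With the section `ρ` of the labelling, a single vector of `H n` outside the hyperplane `q S = 0`
completes the roots of `q'` to a spanning set of the span of `H m`. -/
lemma isFacet_of_eval_eq (hπ : π none = none)
    (heval : ∀ S', eval q' S' = eval q (push π S')) (hq' : Superbalanced q')
    {ρ : ExtTerminal n → ExtTerminal m} (hρ : ρ none = none) (hπρπ : ∀ u, π (ρ (π u)) = π u)
    (hsec : ∀ S, eval q' (push ρ S) = eval q S) (hq : IsFacet (H n) q) :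
    IsFacet (H m) q' := by
  obtain ⟨hvalid, hdim⟩ := hq
  refine ⟨fun S' hS' => heval S' ▸ hvalid _ (push_mem_H hπ hS'), ?_⟩
  obtain ⟨S₀, hS₀, hne⟩ : ∃ S₀ ∈ H n, eval q S₀ ≠ 0 := by
    by_contra! hall
    have : roots (H n) q = H n := Set.ext fun S => ⟨And.left, fun h => ⟨h, hall S h⟩⟩
    rw [this] at hdim
    omega
  have hspan : Submodule.span ℝ (roots (H n) q) ⊔ Submodule.span ℝ {S₀}
      = Submodule.span ℝ (H n) := by
    refine Submodule.eq_of_le_of_finrank_eq (sup_le (Submodule.span_mono fun _ h => h.1) ?_) ?_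
    · exact Submodule.span_mono (by simpa using hS₀)
    · rw [← hdim, finrank_sup_span_singleton fun h => hne (eval_eq_zero_of_mem_span h)]
  have hspan' : Submodule.span ℝ (roots (H m) q') ⊔ Submodule.span ℝ {push ρ S₀}
      = Submodule.span ℝ (H m) := by
    refine le_antisymm (sup_le (Submodule.span_mono fun _ h => h.1) ?_) ?_
    · exact Submodule.span_mono (by simpa using push_mem_H hρ hS₀)
    · refine Submodule.span_le.2 fun S' hS' => ?_
      have hlift : Submodule.span ℝ (H n) ≤ (Submodule.span ℝ (roots (H m) q') ⊔
          Submodule.span ℝ {push ρ S₀}).comap (push ρ) := by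
        rw [← hspan]
        refine sup_le (Submodule.span_le.2 fun S hS => ?_) (Submodule.span_le.2 ?_)
        · refine Submodule.mem_sup_left (Submodule.subset_span ⟨push_mem_H hρ hS.1, ?_⟩)
          rw [hsec, hS.2]
        · rintro _ rfl
          exact Submodule.mem_sup_right (Submodule.mem_span_singleton_self _)
      have h1 := hlift (Submodule.subset_span (push_mem_H hπ hS'))
      have h2 := Submodule.mem_sup_left (T := Submodule.span ℝ {push ρ S₀})
        (sub_push_mem_span hπ heval hq' hρ hπρπ S')
      simpa using Submodule.add_mem _ h2 h1
  rw [← hspan', finrank_sup_span_singleton fun h => hne ?_]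
  rw [← hsec, eval_eq_zero_of_mem_span h]

end Lift

/-- The labelling `π` of a zero-lift, and a map `ρ` which picks one element of `T i` for each `i` in
`K`. Both send everything else to the sink. -/
lemma exists_labelling {m n : ℕ} {K : Set (Fin n)} {T : Fin n → Finset (Fin m)}
    (hT : ∀ i ∈ K, (T i).Nonempty) (hd : K.PairwiseDisjoint T) :
    ∃ (π : ExtTerminal m → ExtTerminal n) (ρ : ExtTerminal n → ExtTerminal m),
      π none = none ∧ ρ none = none ∧ (∀ u, π (ρ (π u)) = π u) ∧
      (∀ i ∈ K, π (ρ (some i)) = some i) ∧ (∀ i ∉ K, π (ρ (some i)) = none) ∧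
      ∀ i ∈ K, ∀ a, π (some a) = some i ↔ a ∈ T i := by
  classical
  let π : ExtTerminal m → ExtTerminal n := fun u => u.bind fun a =>
    if h : ∃ i, i ∈ K ∧ a ∈ T i then some h.choose else none
  have hπ (i) (hi : i ∈ K) (a) (ha : a ∈ T i) : π (some a) = some i := by
    have h : ∃ i, i ∈ K ∧ a ∈ T i := ⟨i, hi, ha⟩
    have h1 : π (some a) = some h.choose := by simp only [π, Option.bind_some, dif_pos h]
    rw [h1]
    by_contra hne
    have := hd h.choose_spec.1 hi (fun e => hne (congrArg some e))
    exact Finset.disjoint_left.1 this h.choose_spec.2 ha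
  have hπ' (a i) (h : π (some a) = some i) : i ∈ K ∧ a ∈ T i := by
    simp only [π, Option.bind_some] at h
    split_ifs at h with h0
    cases h
    exact h0.choose_spec
  let ρ : ExtTerminal n → ExtTerminal m := fun u => u.bind fun i => 
    if h : i ∈ K then some (hT i h).choose else none
  have h1 : ∀ i ∈ K, π (ρ (some i)) = some i := by
    intro i hi
    have : ρ (some i) = some (hT i hi).choose := by simp [ρ, hi]
    rw [this, hπ i hi _ (hT i hi).choose_spec]
  refine ⟨π, ρ, rfl, rfl, fun u => ?_, h1, fun i hi => by simp [ρ, π, hi], fun i hi a =>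
    ⟨fun h => (hπ' a i h).2, hπ i hi a⟩⟩
  rcases u with _ | a
  · rfl
  · cases h : π (some a) with
    | none => rfl
    | some i => exact h1 i (hπ' a i h).1

end HolographicEntropy

open HolographicEntropy in
theorem theorem4p9 (n : ℕ) (q : HolographicEntropy.Vec n)
    (hfacet : HolographicEntropy.IsFacet (HolographicEntropy.H n) q)
    (hsuper : HolographicEntropy.Superbalanced q)
    (q' : HolographicEntropy.Vec (n + 1)) (hlift : HolographicEntropy.IsZeroLift q q') :
    HolographicEntropy.IsFacet (HolographicEntropy.H (n + 1)) q' ∧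
      HolographicEntropy.Superbalanced q' := by
  obtain ⟨T, hT, hd, rfl⟩ := hlift
  obtain ⟨π, ρ, hπ, hρ, hπρπ, hK, hK', hπT⟩ := exists_labelling hT hd
  have heval (S') : eval (substitute (fun I => I.biUnion T) q) S' = eval q (push π S') := by
    rw [eval_substitute, eval]
    refine Finset.sum_congr rfl fun I _ => ?_
    by_cases hI : q I = 0
    · simp [hI]
    · have hpre : I.1.biUnion T = pre π I.1 := by
        ext a
        have hmem (i) (hi : i ∈ I.1) := hπT i ⟨I, hI, hi⟩ a
        simp only [pre, Finset.mem_biUnion, Finset.mem_filter, Finset.mem_univ, true_and,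
          Finset.mem_map, Function.Embedding.some_apply]
        exact exists_congr fun i => and_congr_right fun hi => by rw [← hmem i hi, eq_comm]
      rw [hpre, push_apply]
  have hsec (S) : eval (substitute (fun I => I.biUnion T) q) (push ρ S) = eval q S := by
    rw [heval, push_push hπ hρ]
    refine Finset.sum_congr rfl fun I _ => ?_
    by_cases hI : q I = 0
    · simp [hI]
    · have hpre : pre (π ∘ ρ) I.1 = I.1 := by
        ext a
        by_cases ha : a ∈ appearing q
        · simp [pre, hK a ha]
        · have : a ∉ I.1 := fun h => ha ⟨I, hI, h⟩
          simp [pre, hK' a ha, this]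
      rw [push_apply, hpre, entry_coe]
  have hsuper' := superbalanced_of_eval_eq hπ heval hsuper
  exact ⟨isFacet_of_eval_eq hπ heval hsuper' hρ hπρπ hsec hfacet, hsuper'⟩
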